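/- A \emph{game} $G$ consists of a probability distribution $\mu$ over oracles $f\colon[M]\to[N]$, for each oracle $f$ a discrete probability distribution $\pi_f$ over challenges, and for each oracle $f$ and challenge $\mathsf{ch}$ a set $\mathcal R_{f,\mathsf{ch}}$ of accepted outcomes. An algorithm wins if, for $f\sim\mu$ and $\mathsf{ch}\sim\pi_f$, its output lies in $\mathcal R_{f,\mathsf{ch}}$. For $S,T\in\mathbb N$, let $\varepsilon_G(T)$ be the optimal (i.e. supremal) winning probability of classical, possibly randomized, adaptive algorithms which are given $\mathsf{ch}$ and make at most $T$ classical queries to $f$, and let $\varepsilon_G(S,T)$ be the optimal winning probability when the algorithm is in addition given an $S$-bit advice string $\sigma_f$ that may depend arbitrarily on $f$ (but not on $\mathsf{ch}$). For $K\ge1$, the \emph{salted game} $G_K$ has as oracle $K$ independent samples $f_1,\dots,f_K\sim\mu$ (viewed as one function on $[K]\times[M]$); the challenge is $(k,\mathsf{ch}_k)$ with $k\in[K]$ uniform and $\mathsf{ch}_k\sim\pi_{f_k}$; the accepted outcomes are $\mathcal R_{f_k,\mathsf{ch}_k}$. For $n\in\mathbb N$, the \emph{multi-challenge game} $G^n$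 has oracle $f\sim\mu$, challenge $(\mathsf{ch}^1,\dots,\mathsf{ch}^n)$ sampled independently from $\pi_f$, and accepted outcomes $\mathcal R_{f,\mathsf{ch}^1}\times\cdots\times\mathcal R_{f,\mathsf{ch}^n}$. For $n\ge1$ put $\delta_G(n,T)=\varepsilon_{G^n}(nT)^{1/n}$. (1) For every game $G$, every integer $K\ge1$ and all $S,T\in\mathbb N$, $$\varepsilon_{G_K}(S,T)\le 2e^2\cdot\inf_{L\in\mathbb Z_{\ge1}}2^{S/L}\max_{\substack{n_1,\dots,n_K\in\mathbb N\\ n_1+\cdots+n_K=L}}\ \sum_{k\colon n_k\ge1}\frac{\delta_G(n_k,T)}{\min\{K,L\}}.$$ (2) For every real $c>0$ there is a constant $C>0$, depending only on $c$, such that for every game $G$, every integer $K\ge1$ and all $S,T\in\mathbb N$ with $S\ge cK$, $$\varepsilon_{G_K}(S,T)\le C\cdot\max_{\substack{n_1,\dots,n_K\in\mathbb N\\ n_1+\cdots+n_K=S}}\ \sum_{k\colon n_k\ge1}\frac{\delta_G(n_k,T)}{K}.$$ (3) For every real $c>1$ there is a constant $C>0$, depending only on $c$, such that for every game $G$, every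 integer $K\ge1$ and all $S,T\in\mathbb N$ with $S\ge cK$, $$\varepsilon_{G_K}(S,T)\le C\cdot\max_{\substack{n_1,\dots,n_K\ge1\\ n_1+\cdots+n_K=S}}\ \sum_{k=1}^K\frac{\delta_G(n_k,T)}{K}.$$ -/

import Mathlib

open scoped ENNReal

universe u v

noncomputable section

namespace SaltedGames

/-- The law of `n` independent samples from `p`. -/
def iid {α : Type*} (p : PMF α) : (n : ℕ) → PMF (Fin n → α)
  | 0 => PMF.pure Fin.elim0
  | n + 1 => p.bind fun x => (iid p n).map fun xs => (Fin.cons x xs : Fin (n + 1) → α)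

/-- The defining property of a product law: the probability of a tuple is the product of the
probabilities of its entries. -/
theorem iid_apply {α : Type*} (p : PMF α) (n : ℕ) (x : Fin n → α) :
    iid p n x = ∏ i, p (x i) := by
  induction n with
  | zero => simp [iid, Subsingleton.elim x Fin.elim0]
  | succ n ih =>
    classical
    rw [iid, PMF.bind_apply, Fin.prod_univ_succ, tsum_eq_single (x 0)]
    · rw [PMF.map_apply, tsum_eq_single (Fin.tail x)]
      · simp [ih, Fin.tail]
      · intro y hy
        rw [if_neg]
        intro h
        exact hy (by rw [h, Fin.tail_cons])
    · intro a ha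
      rw [PMF.map_apply]
      rw [ENNReal.tsum_eq_zero.2, mul_zero]
      intro y
      rw [if_neg]
      intro h
      exact ha (by rw [h, Fin.cons_zero])

/-- A deterministic adaptive query algorithm with access to an oracle `D → R` and output in `A`:
it either outputs a value or makes one query and continues depending on the answer. -/
inductive QueryAlg (D R : Type) (A : Type v) : Type v
  | output (a : A) : QueryAlg D R A
  | query (x : D) (next : R → QueryAlg D R A) : QueryAlg D R A

/-- The output of the algorithm when its queries are answered by `f`. -/
def QueryAlg.run {D R : Type} {A : Type v} (f : D → R) : QueryAlg D R A → A
  | .output a => a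
  | .query x next => (next (f x)).run f

/-- The algorithm makes at most `T` queries, whatever the answers are. -/
def QueryAlg.QueriesAtMost {D R : Type} {A : Type v} : ℕ → QueryAlg D R A → Prop
  | _, .output _ => True
  | 0, .query _ _ => False
  | T + 1, .query _ next => ∀ r, (next r).QueriesAtMost T

/-- A randomized algorithm with input in `I` making at most `T` oracle queries: a distribution of
deterministic `T`-query algorithms, one for each input. -/
structure RandAlg (I : Type u) (D R : Type) (A : Type v) (T : ℕ) where
  law : PMF (I → QueryAlg D R A)
  budget : ∀ B ∈ law.support, ∀ i, (B i).QueriesAtMost T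

/-- The distribution of the output on oracle `f` and input `i`. -/
def RandAlg.exec {I : Type u} {D R : Type} {A : Type v} {T : ℕ}
    (B : RandAlg I D R A T) (f : D → R) (i : I) : PMF A :=
  B.law.map fun b => (b i).run f

/-- A game: a distribution of oracles `f : D → R`, for each oracle a distribution of challenges,
and for each oracle and challenge a set of accepted outcomes. -/
structure Game (D R : Type) (Ch : Type u) (A : Type v) where
  oracle : PMF (D → R)
  challenge : (D → R) → PMF Ch
  accept : (D → R) → Ch → Set A

namespace Game

variable {D R : Type} {Ch : Type u} {A : Type v}

/-- The winning probability of a player who, on oracle `f` and challenge `ch`, produces a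
(random) answer with law `play f ch`. -/
def winProb (G : Game D R Ch A) (play : (D → R) → Ch → PMF A) : ℝ≥0∞ :=
  (G.oracle.bind fun f => (G.challenge f).bind fun ch =>
    (play f ch).map fun a => a ∈ G.accept f ch) True

/-- The optimal winning probability of algorithms with at most `T` queries. -/
def eps (G : Game D R Ch A) (T : ℕ) : ℝ :=
  (⨆ B : RandAlg Ch D R A T, G.winProb fun f ch => B.exec f ch).toReal

/-- The optimal winning probability of algorithms with at most `T` queries which receive, besides
the challenge, an `S`-bit advice string depending arbitrarily on the oracle. -/
def epsAdvice (G : Game D R Ch A) (S T : ℕ) : ℝ :=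
  (⨆ (advice : (D → R) → (Fin S → Bool)) (B : RandAlg ((Fin S → Bool) × Ch) D R A T),
    G.winProb fun f ch => B.exec f (advice f, ch)).toReal

/-- The salted game with salt space `Fin K`: the joint oracle consists of `K` independent oracles
of `G`, the challenge is a uniform salt `k` with a challenge for the `k`-th oracle, and the answer
has to be accepted for the `k`-th oracle and that challenge. -/
def salted (G : Game D R Ch A) (K : ℕ) [NeZero K] : Game (Fin K × D) R (Fin K × Ch) A where
  oracle := (iid G.oracle K).map fun fs x => fs x.1 x.2
  challenge g := (PMF.uniformOfFintype (Fin K)).bind fun k =>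
    (G.challenge fun x => g (k, x)).map fun ch => (k, ch)
  accept g ch := G.accept (fun x => g (ch.1, x)) ch.2

/-- The multi-challenge game: `n` independent challenges for the same oracle, all of which have
to be answered correctly. -/
def multi (G : Game D R Ch A) (n : ℕ) : Game D R (Fin n → Ch) (Fin n → A) where
  oracle := G.oracle
  challenge f := iid (G.challenge f) n
  accept f ch := {a | ∀ i, a i ∈ G.accept f (ch i)}

/-- The `n`-th root of the optimal winning probability of `n * T`-query algorithms in the
`n`-challenge game; it is only used for `n ≥ 1`. -/
def delta (G : Game D R Ch A) (n T : ℕ) : ℝ :=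
  (G.multi n).eps (n * T) ^ (1 / (n : ℝ))

end Game

end SaltedGames

end

/-! For fixed advice `s`, let `p_s(f)` be the success probability on the joint oracle `f`. By
Jensen, the `L`-th power of the winning probability is at most the `L`-th moment of `p_{σ(f)}(f)`,
and a union bound over all advice strings leaves `2^S` times the largest `L`-th moment of `p_s` for
fixed `s`.

Since `p_s` is the mean of the success probabilities on the `K` salts, that moment is a multinomial
sum of terms `E ∏ p_k ^ n_k`. Such a term is the probability that algorithms for the games `G^{n_k}`
all win, each with `n_k T` queries, but to all the oracles. Foreign queries do not help
(`jointPayoff_le_prod_optPayoff`): the runs can be interleaved so that an oracle receives, before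
its own algorithm stops, no more queries than that algorithm has. A foreign query is charged to the
queried oracle, whose algorithm then owes a query and moves next; queries to the oracle of a
finished algorithm are free. So the term is at most `∏ δ(n_k)^{n_k}`.

Finally `y^n / n! ≤ e^y` turns the multinomial sum into a bound by the largest sum of the `δ(n_k)`
(`sum_multinomial_mul_prod_le`). Part (2) takes `L = S`; part (3) takes `L = S - K` for `K ≥ 2`, and
spends the other `K` challenges on reaching every salt. -/

namespace SaltedGames

/-! ### Query algorithms against one weighted oracle -/

open Classical in
/-- The total weight `g` of the oracles on which `b` gives an accepted output. -/
noncomputable def payoff {D R : Type} {A : Type v} [Fintype (D → R)] (acc : (D → R) → Set A)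
    (g : (D → R) → ℝ≥0∞) (b : QueryAlg D R A) : ℝ≥0∞ :=
  ∑ f, if b.run f ∈ acc f then g f else 0

/-- The best payoff of algorithms with at most `t` queries. -/
noncomputable def optPayoff {D R : Type} {A : Type v} [Fintype (D → R)] (acc : (D → R) → Set A)
    (g : (D → R) → ℝ≥0∞) (t : ℕ) : ℝ≥0∞ :=
  ⨆ (b : QueryAlg D R A) (_ : b.QueriesAtMost t), payoff acc g b

open Classical in
/-- The weight `g` restricted to the oracles which answer `r` on the query `x`. -/
noncomputable def restrictAnswer {D R : Type} (g : (D → R) → ℝ≥0∞) (x : D) (r : R) :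
    (D → R) → ℝ≥0∞ :=
  fun f => if f x = r then g f else 0

section Payoff

variable {D R : Type} {A : Type v} [Fintype (D → R)]
  (acc : (D → R) → Set A) (g : (D → R) → ℝ≥0∞)

theorem payoff_le_optPayoff {t : ℕ} {b : QueryAlg D R A} (hb : b.QueriesAtMost t) :
    payoff acc g b ≤ optPayoff acc g t :=
  le_iSup₂_of_le b hb le_rfl

/-- The payoff depends only on the set of oracles where the algorithm succeeds, so it takes finitely
many values even if there are infinitely many answers. -/
theorem exists_payoff_eq_optPayoff [Nonempty A] (t : ℕ) :
    ∃ b : QueryAlg D R A, b.QueriesAtMost t ∧ payoff acc g b = optPayoff acc g t := by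
  classical
  set s : Set ℝ≥0∞ := payoff acc g '' {b | b.QueriesAtMost t} with hs
  have hfin : s.Finite := by
    refine (Set.finite_range fun W : Set (D → R) => ∑ f, if f ∈ W then g f else 0).subset ?_
    rintro _ ⟨b, -, rfl⟩
    exact ⟨{f | b.run f ∈ acc f}, rfl⟩
  have hne : s.Nonempty :=
    ⟨_, QueryAlg.output (Classical.arbitrary A), by cases t <;> trivial, rfl⟩
  obtain ⟨b, hb, hbe⟩ := hne.csSup_mem hfin
  exact ⟨b, hb, by rw [hbe, hs, sSup_image]; rfl⟩

/-- Asking `x` and then continuing optimally for each answer is itself an algorithm with one more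
query. -/
theorem sum_optPayoff_restrictAnswer_le [Nonempty A] [Fintype R] (x : D) (t : ℕ) :
    ∑ r, optPayoff acc (restrictAnswer g x r) t ≤ optPayoff acc g (t + 1) := by
  classical
  choose b hb hbe using fun r => exists_payoff_eq_optPayoff acc (restrictAnswer g x r) t
  have hq : (QueryAlg.query x b).QueriesAtMost (t + 1) := hb
  refine le_trans (le_of_eq ?_) (payoff_le_optPayoff acc g hq)
  simp only [← hbe, payoff, restrictAnswer]
  rw [Finset.sum_comm]
  refine Finset.sum_congr rfl fun f _ => ?_
  rw [Finset.sum_eq_single (f x)]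
  · simp only [QueryAlg.run, if_true]
    congr
  · intro r _ hr
    simp [hr.symm]
  · simp

/-- This makes queries to the oracle of a finished algorithm free: its output no longer adapts to
the answer. -/
theorem sum_payoff_restrictAnswer [Fintype R] (x : D) (b : QueryAlg D R A) :
    ∑ r, payoff acc (restrictAnswer g x r) b = payoff acc g b := by
  classical
  simp only [payoff, restrictAnswer]
  rw [Finset.sum_comm]
  refine Finset.sum_congr rfl fun f _ => ?_
  rw [Finset.sum_eq_single (f x)]
  · simp
  · intro r _ hr
    simp [hr.symm]
  · simp

end Payoff

/-! ### Simultaneous algorithms on independent oracles -/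

/-- The payoff that is still reachable for one oracle out of several with `t` queries: if the
algorithm has finished, its output is fixed. -/
noncomputable def reachable {E D R : Type} {A : Type v} [Fintype (D → R)] (acc : (D → R) → Set A)
    (g : (D → R) → ℝ≥0∞) (t : ℕ) : QueryAlg E R A → ℝ≥0∞
  | .output a => payoff acc g (.output a)
  | .query _ _ => optPayoff acc g t

theorem reachable_le_optPayoff {E D R : Type} {A : Type v} [Fintype (D → R)]
    (acc : (D → R) → Set A) (g : (D → R) → ℝ≥0∞) (t : ℕ) (b : QueryAlg E R A) :
    reachable acc g t b ≤ optPayoff acc g t := by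
  cases b with
  | output a => exact payoff_le_optPayoff acc g (by cases t <;> trivial)
  | query x next => exact le_rfl

section Joint

variable {ι D R : Type} [Fintype ι] [Fintype (D → R)] {A : ι → Type v}
  (acc : ∀ k, (D → R) → Set (A k))

open Classical in
/-- The total product weight of the tuples of oracles on which every algorithm succeeds on its
own oracle. -/
noncomputable def jointPayoff (g : ι → (D → R) → ℝ≥0∞) (b : ∀ k, QueryAlg (ι × D) R (A k)) :
    ℝ≥0∞ :=
  ∑ fs : ι → D → R, ∏ k, if (b k).run (fun z => fs z.1 z.2) ∈ acc k (fs k) then g k (fs k) else 0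

theorem jointPayoff_output (g : ι → (D → R) → ℝ≥0∞) (b : ∀ k, QueryAlg (ι × D) R (A k))
    (a : ∀ k, A k) (hb : ∀ k, b k = .output (a k)) :
    jointPayoff acc g b = ∏ k, payoff (acc k) (g k) (.output (a k)) := by
  classical
  simp only [jointPayoff, payoff, hb, QueryAlg.run]
  rw [Finset.prod_univ_sum, Fintype.piFinset_univ]
  congr!

/-- The tuples are partitioned by the answer to the query. Conditioning on it restricts only the
weight of the `j`-th oracle, so the weight remains a product. -/
theorem jointPayoff_eq_sum [DecidableEq ι] [Fintype R] (g : ι → (D → R) → ℝ≥0∞)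
    (b : ∀ k, QueryAlg (ι × D) R (A k)) {k j : ι} {x : D} {next : R → QueryAlg (ι × D) R (A k)}
    (hk : b k = .query (j, x) next) :
    jointPayoff acc g b = ∑ r, jointPayoff acc
      (Function.update g j (restrictAnswer (g j) x r)) (Function.update b k (next r)) := by
  classical
  simp only [jointPayoff]
  rw [Finset.sum_comm]
  refine Finset.sum_congr rfl fun fs _ => ?_
  rw [Finset.sum_eq_single (fs j x)]
  · refine Finset.prod_congr rfl fun i _ => ?_
    have h1 : (Function.update b k (next (fs j x)) i).run (fun z => fs z.1 z.2)
        = (b i).run fun z => fs z.1 z.2 := by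
      rcases eq_or_ne i k with rfl | hi
      · rw [Function.update_self, hk]; rfl
      · rw [Function.update_of_ne hi]
    have h2 : Function.update g j (restrictAnswer (g j) x (fs j x)) i (fs i) = g i (fs i) := by
      rcases eq_or_ne i j with rfl | hi
      · rw [Function.update_self]; simp [restrictAnswer]
      · rw [Function.update_of_ne hi]
    rw [h1, h2]
  · intro r _ hr
    refine Finset.prod_eq_zero (Finset.mem_univ j) ?_
    simp [restrictAnswer, hr.symm]
  · simp

/-- Only the factor at `j` needs to be summed over the answers. If `k ≠ j`, the factor at `k` was
`optPayoff` before the step, which also bounds it afterwards. -/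
theorem jointPayoff_le_of_step [DecidableEq ι] [Fintype R] (g : ι → (D → R) → ℝ≥0∞)
    (b : ∀ k, QueryAlg (ι × D) R (A k)) (t : ι → ℕ) (s : ℕ) {k j : ι} {x : D}
    {next : R → QueryAlg (ι × D) R (A k)} (hk : b k = .query (j, x) next)
    (hstep : ∀ r, jointPayoff acc (Function.update g j (restrictAnswer (g j) x r))
        (Function.update b k (next r)) ≤
      ∏ i, reachable (acc i) (Function.update g j (restrictAnswer (g j) x r) i)
        (Function.update t j s i) (Function.update b k (next r) i))
    (hj : ∑ r, reachable (acc j) (restrictAnswer (g j) x r) s (Function.update b k (next r) j) ≤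
      reachable (acc j) (g j) (t j) (b j)) :
    jointPayoff acc g b ≤ ∏ i, reachable (acc i) (g i) (t i) (b i) := by
  classical
  rw [jointPayoff_eq_sum acc g b hk]
  have key : ∀ r, jointPayoff acc (Function.update g j (restrictAnswer (g j) x r))
        (Function.update b k (next r)) ≤
      reachable (acc j) (restrictAnswer (g j) x r) s (Function.update b k (next r) j) *
        ∏ i ∈ Finset.univ.erase j, reachable (acc i) (g i) (t i) (b i) := by
    intro r
    refine (hstep r).trans ?_
    rw [← Finset.mul_prod_erase _ _ (Finset.mem_univ j), Function.update_self,
      Function.update_self]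
    refine mul_le_mul_right (Finset.prod_le_prod' fun i hi => ?_) _
    have hij : i ≠ j := Finset.ne_of_mem_erase hi
    rw [Function.update_of_ne hij, Function.update_of_ne hij]
    rcases eq_or_ne i k with rfl | hik
    · rw [hk]
      exact reachable_le_optPayoff _ _ _ _
    · rw [Function.update_of_ne hik]
  refine (Finset.sum_le_sum fun r _ => key r).trans ?_
  rw [← Finset.sum_mul, ← Finset.mul_prod_erase _ _ (Finset.mem_univ j)]
  exact mul_le_mul_left hj _

end Joint

section Schedule

variable {ι D R : Type} [Fintype ι] [DecidableEq ι] [Fintype (D → R)] [Fintype R]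
  {A : ι → Type v} [∀ k, Nonempty (A k)] (acc : ∀ k, (D → R) → Set (A k))

/-- Scheduling of the algorithms. The algorithm of `k` makes at most `q k` further queries, and
the `k`-th oracle may receive at most `t k` further queries before this algorithm has finished.
At most one of them, the debtor `d`, may make one query more than its oracle may receive, and it
wants to query a foreign oracle next. -/
theorem jointPayoff_le_prod_reachable (m : ℕ) :
    ∀ (g : ι → (D → R) → ℝ≥0∞) (b : ∀ k, QueryAlg (ι × D) R (A k)) (q t : ι → ℕ)
      (d : Option ι), (∀ k, (b k).QueriesAtMost (q k)) →
      (∀ k, q k ≤ t k + if d = some k then 1 else 0) →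
      (∀ k, d = some k → ∃ j x next, j ≠ k ∧ b k = .query (j, x) next) →
      ∑ k, q k ≤ m →
      jointPayoff acc g b ≤ ∏ k, reachable (acc k) (g k) (t k) (b k) := by
  induction m with
  | zero =>
    intro g b q t d hb hq hd hm
    have hout : ∀ k, ∃ a, b k = .output a := by
      intro k
      have h0 : q k = 0 := by
        have := Finset.single_le_sum (f := q) (fun _ _ => Nat.zero_le _) (Finset.mem_univ k)
        omega
      have := hb k
      rw [h0] at this
      match hbk : b k with
      | .output a => exact ⟨a, rfl⟩
      | .query x next => rw [hbk] at this; exact this.elim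
    choose a ha using hout
    rw [jointPayoff_output acc g b a ha]
    exact le_of_eq (Finset.prod_congr rfl fun k _ => by rw [ha k]; rfl)
  | succ m ih =>
    intro g b q t d hb hq hd hm
    -- advancing the algorithm of `k` by one query leaves a state covered by induction
    have advance : ∀ {k j : ι} {x : D} {next : R → QueryAlg (ι × D) R (A k)}
        (hk : b k = .query (j, x) next) (s : ℕ) (d' : Option ι),
        (∀ i, Function.update q k (q k - 1) i ≤
          Function.update t j s i + if d' = some i then 1 else 0) →
        (∀ r i, d' = some i → ∃ j x next', j ≠ i ∧
          Function.update b k (next r) i = .query (j, x) next') →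
        (∑ r, reachable (acc j) (restrictAnswer (g j) x r) s (Function.update b k (next r) j) ≤
          reachable (acc j) (g j) (t j) (b j)) →
        jointPayoff acc g b ≤ ∏ i, reachable (acc i) (g i) (t i) (b i) := by
      intro k j x next hk s d' h1 h2 h3
      have hqk : 1 ≤ q k ∧ ∀ r, (next r).QueriesAtMost (q k - 1) := by
        have := hb k
        rw [hk] at this
        match hqk : q k with
        | 0 => rw [hqk] at this; exact this.elim
        | n + 1 => rw [hqk] at this; exact ⟨by omega, this⟩
      refine jointPayoff_le_of_step acc g b t s hk (fun r => ?_) h3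
      refine ih _ _ (Function.update q k (q k - 1)) _ d' (fun i => ?_) h1 (h2 r) ?_
      · rcases eq_or_ne i k with rfl | hi
        · rw [Function.update_self, Function.update_self]; exact hqk.2 r
        · rw [Function.update_of_ne hi, Function.update_of_ne hi]; exact hb i
      · have he : ∑ i ∈ Finset.univ.erase k, Function.update q k (q k - 1) i =
            ∑ i ∈ Finset.univ.erase k, q i :=
          Finset.sum_congr rfl fun i hi => Function.update_of_ne (Finset.ne_of_mem_erase hi) _ _
        rw [← Finset.add_sum_erase _ _ (Finset.mem_univ k)] at hm ⊢
        rw [Function.update_self, he]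
        omega
    have qpos : ∀ {k z next}, b k = .query z next → 1 ≤ q k := by
      intro k z next hk
      have := hb k
      rw [hk] at this
      match hqk : q k with
      | 0 => rw [hqk] at this; exact this.elim
      | n + 1 => omega
    -- An own query of a non-debtor lowers `q k` and `t k` together, so the invariant persists.
    by_cases hown : ∃ k x next, d ≠ some k ∧ b k = .query (k, x) next
    · obtain ⟨k, x, next, hdk, hk⟩ := hown
      have hqk := hq k
      rw [if_neg hdk] at hqk
      have hpos := qpos hk
      refine advance hk (t k - 1) d (fun i => ?_) (fun r i hi => ?_) ?_
      · rcases eq_or_ne i k with rfl | hi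
        · rw [Function.update_self, Function.update_self]; omega
        · rw [Function.update_of_ne hi, Function.update_of_ne hi]; exact hq i
      · have hik : i ≠ k := by rintro rfl; exact hdk hi
        rw [Function.update_of_ne hik]
        exact hd i hi
      · rw [hk]
        refine (Finset.sum_le_sum fun r _ => reachable_le_optPayoff _ _ _ _).trans ?_
        have := sum_optPayoff_restrictAnswer_le (acc k) (g k) x (t k - 1)
        rwa [Nat.sub_add_cancel (by omega)] at this
    · push Not at hown
      -- the debtor, or else any unfinished algorithm, is advanced
      have foreign : ∀ {k j x next}, b k = .query (j, x) next → j ≠ k →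
          (∀ i, d = some i → i = k) →
          jointPayoff acc g b ≤ ∏ i, reachable (acc i) (g i) (t i) (b i) := by
        intro k j x next hk hjk hdk
        have hpos := qpos hk
        have hqk : q k - 1 ≤ t k := by
          have := hq k
          split_ifs at this <;> omega
        have hother : ∀ i, i ≠ k → q i ≤ t i := by
          intro i hi
          have := hq i
          rwa [if_neg fun h => hi (hdk i h), add_zero] at this
        -- The step lowers `q k`, which settles any debt of `k`. If `j` has finished, nothing is
        -- charged and no debtor remains.
        match hbj : b j with
        | .output a =>
          refine advance hk (t j) none (fun i => ?_) (fun r i hi => by cases hi) ?_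
          · rw [Function.update_eq_self]
            rcases eq_or_ne i k with rfl | hi
            · rw [Function.update_self]; simpa using hqk
            · rw [Function.update_of_ne hi]; simpa using hother i hi
          · simp only [Function.update_of_ne hjk, hbj]
            exact (sum_payoff_restrictAnswer (acc j) (g j) x _).le
        | .query (i', y) next' =>
          -- Charging the unfinished `j` makes it the debtor. Its next query is foreign because
          -- `hown` excludes own queries of non-debtors.
          have hposj := qpos hbj
          have htj := hother j hjk
          refine advance hk (t j - 1) (some j) (fun i => ?_) (fun r i hi => ?_) ?_
          · rcases eq_or_ne i k with rfl | hi
            · rw [Function.update_self, Function.update_of_ne hjk.symm]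
              exact hqk.trans (Nat.le_add_right _ _)
            · rw [Function.update_of_ne hi]
              rcases eq_or_ne i j with rfl | hij
              · rw [Function.update_self, if_pos rfl]; omega
              · rw [Function.update_of_ne hij]
                exact (hother i hi).trans (Nat.le_add_right _ _)
          · obtain rfl : j = i := Option.some.inj hi
            rw [Function.update_of_ne hjk]
            refine ⟨i', y, next', ?_, hbj⟩
            rintro rfl
            exact hown i' y next' (fun h => hjk (hdk i' h)) hbj
          · rw [hbj]
            refine (Finset.sum_le_sum fun r _ => reachable_le_optPayoff _ _ _ _).trans ?_
            have := sum_optPayoff_restrictAnswer_le (acc j) (g j) x (t j - 1)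
            rwa [Nat.sub_add_cancel (by omega)] at this
      match d, hd with
      | some k, hd =>
        obtain ⟨j, x, next, hjk, hk⟩ := hd k rfl
        exact foreign hk hjk fun i hi => (Option.some.inj hi).symm
      | none, _ =>
        by_cases hout : ∀ k, ∃ a, b k = .output a
        · choose a ha using hout
          rw [jointPayoff_output acc g b a ha]
          exact le_of_eq (Finset.prod_congr rfl fun k _ => by rw [ha k]; rfl)
        · push Not at hout
          obtain ⟨k, hk⟩ := hout
          match hbk : b k with
          | .output a => exact (hk a hbk).elim
          | .query (j, x) next =>
            refine foreign hbk ?_ fun i hi => by cases hi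
            rintro rfl
            exact hown j x next (by simp) hbk

/-- Algorithms playing simultaneously on independent oracles, each allowed to query all the
oracles, do not succeed better than independent players. -/
theorem jointPayoff_le_prod_optPayoff (g : ι → (D → R) → ℝ≥0∞)
    (b : ∀ k, QueryAlg (ι × D) R (A k)) (q : ι → ℕ) (hb : ∀ k, (b k).QueriesAtMost (q k)) :
    jointPayoff acc g b ≤ ∏ k, optPayoff (acc k) (g k) (q k) :=
  (jointPayoff_le_prod_reachable acc _ g b q q none hb (fun _ => Nat.le_add_right _ _)
    (fun _ h => by cases h) le_rfl).trans
    (Finset.prod_le_prod' fun k _ => reachable_le_optPayoff _ _ _ _)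

end Schedule

/-! ### The multinomial estimate -/

theorem factorial_mul_card_piAntidiag_le (K L : ℕ) :
    L.factorial * (Finset.piAntidiag (Finset.univ : Finset (Fin K)) L).card ≤ (K + L) ^ L := by
  -- These tuples are counted as multisets of size `L`; multiplied by `L!`, their number is a rising
  -- factorial.
  rw [← Finset.map_sym_eq_piAntidiag, Finset.card_map, Finset.sym_univ, Finset.card_univ,
    Sym.card_sym_eq_multichoose, Fintype.card_fin]
  rcases K with _ | K
  · rcases L with _ | L
    · simp
    · simp
  · have h : L.factorial * (K + 1).multichoose L = (K + 1).ascFactorial L := by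
      rw [Nat.multichoose_eq, Nat.ascFactorial_eq_factorial_mul_choose]
      congr 2
      omega
    rw [h]
    exact (Nat.ascFactorial_le_pow_add K L).trans (Nat.pow_le_pow_left (by omega) L)

/-- Apply `y ^ n / n! ≤ exp y` with `y = L * δ / X` to each factor: the exponents then add up to at
most `L`. -/
theorem prod_pow_div_factorial_le {K L : ℕ} (hL : 1 ≤ L) {δ : ℕ → ℝ} (hδ : ∀ n, 0 ≤ δ n) {X : ℝ}
    (n : Fin K → ℕ) (hn : ∑ k, n k = L) (hX : ∑ k with 1 ≤ n k, δ (n k) ≤ X) :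
    ∏ k, δ (n k) ^ n k / (n k).factorial ≤ (Real.exp 1 * X / L) ^ L := by
  have hL0 : (0 : ℝ) < L := by exact_mod_cast hL
  have hX0 : 0 ≤ X := (Finset.sum_nonneg fun k _ => hδ _).trans hX
  -- For `X = 0` one cannot divide by `X`, but some `n k ≥ 1` has `δ (n k) = 0`, and the product
  -- vanishes.
  rcases hX0.eq_or_lt with rfl | hX0
  · obtain ⟨k, hk⟩ : ∃ k, 1 ≤ n k := by
      by_contra! h
      have : ∑ k, n k = 0 := Finset.sum_eq_zero fun k _ => by have := h k; omega
      omega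
    have h0 : δ (n k) = 0 := le_antisymm
      ((Finset.single_le_sum (f := fun k => δ (n k)) (fun i _ => hδ _)
        (Finset.mem_filter.2 ⟨Finset.mem_univ k, hk⟩)).trans hX) (hδ _)
    rw [Finset.prod_eq_zero (Finset.mem_univ k) (by rw [h0, zero_pow (by omega), zero_div])]
    positivity
  -- Indices with `n k = 0` contribute the factor 1 and no exponential, so `δ 0` never enters.
  · have hfac : ∀ k, δ (n k) ^ n k / (n k).factorial ≤
        (X / L) ^ n k * Real.exp (if 1 ≤ n k then L / X * δ (n k) else 0) := by
      intro k
      split_ifs with h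
      · have := Real.pow_div_factorial_le_exp _ (mul_nonneg (div_pos hL0 hX0).le (hδ (n k))) (n k)
        calc δ (n k) ^ n k / (n k).factorial
            = (X / L) ^ n k * ((L / X * δ (n k)) ^ n k / (n k).factorial) := by
              rw [← mul_div_assoc, ← mul_pow]
              congr 2
              field_simp
          _ ≤ _ := mul_le_mul_of_nonneg_left this (by positivity)
      · have : n k = 0 := by omega
        simp [this]
    calc ∏ k, δ (n k) ^ n k / (n k).factorial
        ≤ ∏ k, (X / L) ^ n k * Real.exp (if 1 ≤ n k then L / X * δ (n k) else 0) :=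
          Finset.prod_le_prod (fun k _ => div_nonneg (pow_nonneg (hδ _) _) (by positivity))
            fun k _ => hfac k
      _ = (X / L) ^ L * Real.exp (L / X * ∑ k with 1 ≤ n k, δ (n k)) := by
          rw [Finset.prod_mul_distrib, Finset.prod_pow_eq_pow_sum, hn, ← Real.exp_sum,
            Finset.mul_sum, Finset.sum_filter]
      _ ≤ (X / L) ^ L * Real.exp L := by
          refine mul_le_mul_of_nonneg_left (Real.exp_le_exp.2 ?_) (by positivity)
          calc (L : ℝ) / X * ∑ k with 1 ≤ n k, δ (n k) ≤ L / X * X :=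
                mul_le_mul_of_nonneg_left hX (by positivity)
            _ = L := by field_simp
      _ = (Real.exp 1 * X / L) ^ L := by
          rw [mul_div_assoc, mul_pow, ← Real.exp_nat_mul, mul_one, mul_comm]

theorem sum_multinomial_mul_prod_le {K L : ℕ} [NeZero K] (hL : 1 ≤ L) {δ : ℕ → ℝ} (hδ : ∀ n, 0 ≤ δ n)
    {X : ℝ} (hX : ∀ n : Fin K → ℕ, ∑ k, n k = L → ∑ k with 1 ≤ n k, δ (n k) ≤ X) :
    ∑ n ∈ Finset.piAntidiag (Finset.univ : Finset (Fin K)) L,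
      (Nat.multinomial Finset.univ n : ℝ) * ∏ k, δ (n k) ^ n k ≤
      (((K : ℝ) + L) * (Real.exp 1 * X / L)) ^ L := by
  have hterm : ∀ n ∈ Finset.piAntidiag (Finset.univ : Finset (Fin K)) L,
      (Nat.multinomial Finset.univ n : ℝ) * ∏ k, δ (n k) ^ n k ≤
        L.factorial * (Real.exp 1 * X / L) ^ L := by
    intro n hn
    have hs : ∑ k, n k = L := (Finset.mem_piAntidiag.1 hn).1
    have hm := Nat.multinomial_spec Finset.univ n
    rw [hs] at hm
    have hm' : (∏ k, ((n k).factorial : ℝ)) * Nat.multinomial Finset.univ n = L.factorial := by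
      exact_mod_cast hm
    have hne : (∏ k, ((n k).factorial : ℝ)) ≠ 0 :=
      Finset.prod_ne_zero_iff.2 fun k _ => by positivity
    calc (Nat.multinomial Finset.univ n : ℝ) * ∏ k, δ (n k) ^ n k
        = L.factorial * ∏ k, δ (n k) ^ n k / (n k).factorial := by
          rw [Finset.prod_div_distrib, ← hm']
          field_simp
      _ ≤ _ := mul_le_mul_of_nonneg_left (prod_pow_div_factorial_le hL hδ n hs (hX n hs))
          (by positivity)
  have hX0 : 0 ≤ X :=
    (Finset.sum_nonneg fun k _ => hδ _).trans (hX (Pi.single 0 L) (by simp))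
  refine (Finset.sum_le_card_nsmul _ _ _ hterm).trans ?_
  rw [nsmul_eq_mul, ← mul_assoc, mul_pow]
  refine mul_le_mul_of_nonneg_right ?_ (by positivity)
  have := factorial_mul_card_piAntidiag_le K L
  rw [mul_comm] at this
  exact_mod_cast this

/-! ### Sequential composition of query algorithms -/

namespace QueryAlg

/-- Run an algorithm and continue depending on its output. -/
def bind {D R : Type} {A : Type u} {B : Type v} :
    QueryAlg D R A → (A → QueryAlg D R B) → QueryAlg D R B
  | .output a, k => k a
  | .query x next, k => .query x fun r => (next r).bind k

theorem run_bind {D R : Type} {A : Type u} {B : Type v} (f : D → R) (b : QueryAlg D R A)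
    (k : A → QueryAlg D R B) : (b.bind k).run f = (k (b.run f)).run f := by
  induction b with
  | output a => rfl
  | query x next ih => exact ih (f x)

theorem QueriesAtMost.mono {D R : Type} {A : Type u} {b : QueryAlg D R A} {s t : ℕ}
    (h : b.QueriesAtMost s) (hst : s ≤ t) : b.QueriesAtMost t := by
  induction b generalizing s t with
  | output a => cases t <;> trivial
  | query x next ih =>
    cases s with
    | zero => exact h.elim
    | succ s =>
      cases t with
      | zero => omega
      | succ t => exact fun r => ih r (h r) (by omega)

theorem QueriesAtMost.bind {D R : Type} {A : Type u} {B : Type v} {b : QueryAlg D R A}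
    {k : A → QueryAlg D R B} {s t : ℕ} (hb : b.QueriesAtMost s)
    (hk : ∀ a, (k a).QueriesAtMost t) : (b.bind k).QueriesAtMost (s + t) := by
  induction b generalizing s with
  | output a => exact (hk a).mono (Nat.le_add_left _ _)
  | query x next ih =>
    cases s with
    | zero => exact hb.elim
    | succ s =>
      rw [Nat.add_right_comm]
      exact fun r => ih r (hb r)

/-- Run several algorithms one after the other. -/
def sequence {D R : Type} {A : Type v} : (n : ℕ) → (Fin n → QueryAlg D R A) →
    QueryAlg D R (Fin n → A)
  | 0, _ => .output Fin.elim0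
  | n + 1, b => (b 0).bind fun a => (sequence n fun i => b i.succ).bind fun as =>
      .output (Fin.cons a as : Fin (n + 1) → A)

theorem run_sequence {D R : Type} {A : Type v} (f : D → R) (n : ℕ)
    (b : Fin n → QueryAlg D R A) : (sequence n b).run f = fun i => (b i).run f := by
  induction n with
  | zero => exact Subsingleton.elim _ _
  | succ n ih =>
    rw [sequence, run_bind, run_bind, ih]
    funext i
    refine Fin.cases ?_ (fun i => ?_) i <;> rfl

theorem QueriesAtMost.sequence {D R : Type} {A : Type v} {n T : ℕ}
    {b : Fin n → QueryAlg D R A} (hb : ∀ i, (b i).QueriesAtMost T) :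
    (sequence n b).QueriesAtMost (n * T) := by
  induction n with
  | zero => cases (0 * T) <;> trivial
  | succ n ih =>
    have h := (hb 0).bind (k := fun a => (QueryAlg.sequence n fun i => b i.succ).bind fun as =>
      .output (Fin.cons a as : Fin (n + 1) → A)) (t := n * T) fun a => by
        have := (ih fun i => hb i.succ).bind (t := 0)
          (k := fun as => .output (Fin.cons a as : Fin (n + 1) → A)) fun _ => trivial
        rwa [add_zero] at this
    exact h.mono (by rw [Nat.succ_mul, add_comm])

end QueryAlg

/-! ### Product laws and expectations -/

theorem tsum_iid_mul_prod {α : Type*} (p : PMF α) (h : α → ℝ≥0∞) (n : ℕ) :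
    ∑' c : Fin n → α, iid p n c * ∏ i, h (c i) = (∑' a, p a * h a) ^ n := by
  simp only [iid_apply, ← Finset.prod_mul_distrib]
  induction n with
  | zero => simp [tsum_fintype]
  | succ n ih =>
    rw [← (Fin.consEquiv fun _ : Fin (n + 1) => α).tsum_eq, ENNReal.tsum_prod', pow_succ', ← ih,
      ← ENNReal.tsum_mul_right]
    refine tsum_congr fun a => ?_
    rw [← ENNReal.tsum_mul_left]
    refine tsum_congr fun c => ?_
    simp [Fin.prod_univ_succ, Fin.consEquiv]

/-- A bound of a sum of products by a product survives summing each factor over its own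
parameter. -/
theorem sum_prod_tsum_le {ι Ω : Type*} [Fintype ι] [Fintype Ω] {C : ι → Type*}
    (X : ∀ k, Ω → C k → ℝ≥0∞) (Y : ∀ k, C k → ℝ≥0∞)
    (h : ∀ c : ∀ k, C k, ∑ w, ∏ k, X k w (c k) ≤ ∏ k, Y k (c k)) :
    ∑ w, ∏ k, ∑' c, X k w c ≤ ∏ k, ∑' c, Y k c := by
  classical
  by_cases hC : ∀ k, Nonempty (C k)
  swap
  · push Not at hC
    obtain ⟨k, hk⟩ := hC
    refine le_of_eq_of_le (Finset.sum_eq_zero fun w _ => ?_) zero_le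
    exact Finset.prod_eq_zero (Finset.mem_univ k) (by simp)
  -- Both sides are linear in each factor, so the parameters can be summed one coordinate at a time;
  -- `s` holds those already summed.
  have key : ∀ (s : Finset ι) (c : ∀ k, C k),
      ∑ w, ∏ k, (if k ∈ s then ∑' a, X k w a else X k w (c k)) ≤
        ∏ k, (if k ∈ s then ∑' a, Y k a else Y k (c k)) := by
    intro s
    induction s using Finset.induction_on with
    | empty => simpa using h
    | insert j s hj ih =>
      intro c
      have split : ∀ (F : ∀ k, C k → ℝ≥0∞),
          ∏ k, (if k ∈ insert j s then ∑' a, F k a else F k (c k)) =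
            ∑' a, ∏ k, (if k ∈ s then ∑' a, F k a else F k (Function.update c j a k)) := by
        intro F
        rw [← Finset.mul_prod_erase _ _ (Finset.mem_univ j),
          if_pos (Finset.mem_insert_self j s), ← ENNReal.tsum_mul_right]
        refine tsum_congr fun a => ?_
        rw [← Finset.mul_prod_erase _ _ (Finset.mem_univ j), if_neg hj, Function.update_self]
        congr 1
        refine Finset.prod_congr rfl fun k hk => ?_
        have hkj := Finset.ne_of_mem_erase hk
        rw [Function.update_of_ne hkj]
        simp [hkj]
      rw [split Y]
      simp only [fun w => split fun k a => X k w a]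
      rw [← Summable.tsum_finsetSum fun _ _ => ENNReal.summable]
      exact ENNReal.tsum_le_tsum fun a => ih _
  simpa using key Finset.univ fun k => (hC k).some

section Expectation

theorem tsum_map_mul {α β : Type*} (p : PMF α) (h : α → β) (F : β → ℝ≥0∞) :
    ∑' y, p.map h y * F y = ∑' x, p x * F (h x) := by
  classical
  simp only [PMF.map_apply, ← ENNReal.tsum_mul_right]
  rw [ENNReal.tsum_comm]
  refine tsum_congr fun x => ?_
  rw [tsum_eq_single (h x)]
  · simp
  · intro y hy
    simp [hy]

theorem tsum_bind_mul {α β : Type*} (p : PMF α) (q : α → PMF β) (F : β → ℝ≥0∞) :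
    ∑' y, p.bind q y * F y = ∑' x, p x * ∑' y, q x y * F y := by
  simp only [PMF.bind_apply, ← ENNReal.tsum_mul_right, ← ENNReal.tsum_mul_left]
  rw [ENNReal.tsum_comm]
  exact tsum_congr fun x => tsum_congr fun y => mul_assoc _ _ _

theorem tsum_mul_le_of_le {α : Type*} (p : PMF α) {F : α → ℝ≥0∞} {c : ℝ≥0∞}
    (h : ∀ x ∈ p.support, F x ≤ c) : ∑' x, p x * F x ≤ c := by
  calc ∑' x, p x * F x ≤ ∑' x, p x * c := by
        refine ENNReal.tsum_le_tsum fun x => ?_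
        by_cases hx : x ∈ p.support
        · exact mul_le_mul_right (h x hx) _
        · rw [(PMF.apply_eq_zero_iff p x).2 hx, zero_mul, zero_mul]
    _ = c := by rw [ENNReal.tsum_mul_right, p.tsum_coe, one_mul]

end Expectation

/-! ### Winning probabilities and moments of the salted game -/

namespace Game

variable {D R : Type} {Ch : Type u} {A : Type v}

open Classical in
/-- The winning probability of the player who answers `ans f ch` on oracle `f` and challenge
`ch`. -/
noncomputable def detWinProb (G : Game D R Ch A) (ans : (D → R) → Ch → A) : ℝ≥0∞ :=
  ∑' f, G.oracle f * ∑' ch, G.challenge f ch * if ans f ch ∈ G.accept f ch then 1 else 0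

theorem winProb_map (G : Game D R Ch A) {X : Type*} (law : PMF X)
    (ans : X → (D → R) → Ch → A) :
    (G.winProb fun f ch => law.map fun x => ans x f ch) = ∑' x, law x * G.detWinProb (ans x) := by
  classical
  have h : ∀ f ch, ((law.map fun x => ans x f ch).map fun a => a ∈ G.accept f ch) True =
      ∑' x, law x * if ans x f ch ∈ G.accept f ch then 1 else 0 := by
    intro f ch
    rw [PMF.map_comp, PMF.map_apply]
    refine tsum_congr fun x => ?_
    by_cases hx : ans x f ch ∈ G.accept f ch <;> simp [hx]
  simp only [winProb, detWinProb, PMF.bind_apply, h, ← ENNReal.tsum_mul_left]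
  calc _ = ∑' f, ∑' x, ∑' ch, G.oracle f * (G.challenge f ch * (law x *
        if ans x f ch ∈ G.accept f ch then 1 else 0)) :=
        tsum_congr fun f => ENNReal.tsum_comm
    _ = _ := by
        rw [ENNReal.tsum_comm]
        refine tsum_congr fun x => tsum_congr fun f => tsum_congr fun ch => ?_
        ring

theorem winProb_le_one (G : Game D R Ch A) (play : (D → R) → Ch → PMF A) :
    G.winProb play ≤ 1 :=
  PMF.coe_le_one _ _

/-- A randomized algorithm wins with an average of the probabilities of deterministic ones, so only
these have to be bounded. -/
theorem winProb_exec_le (G : Game D R Ch A) {I : Type u} {T : ℕ} (B : RandAlg I D R A T)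
    (inp : (D → R) → Ch → I) {c : ℝ≥0∞}
    (h : ∀ b : I → QueryAlg D R A, (∀ i, (b i).QueriesAtMost T) →
      G.detWinProb (fun f ch => (b (inp f ch)).run f) ≤ c) :
    (G.winProb fun f ch => B.exec f (inp f ch)) ≤ c := by
  have := G.winProb_map B.law fun b f ch => (b (inp f ch)).run f
  exact this.le.trans (tsum_mul_le_of_le _ fun b hb => h b (B.budget b hb))

/-- The optimal winning probability of algorithms with at most `T` queries. -/
noncomputable def value (G : Game D R Ch A) (T : ℕ) : ℝ≥0∞ :=
  ⨆ B : RandAlg Ch D R A T, G.winProb fun f ch => B.exec f ch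

theorem value_le_one (G : Game D R Ch A) (T : ℕ) : G.value T ≤ 1 :=
  iSup_le fun _ => G.winProb_le_one _

theorem detWinProb_le_value (G : Game D R Ch A) {T : ℕ} (b : Ch → QueryAlg D R A)
    (hb : ∀ ch, (b ch).QueriesAtMost T) :
    G.detWinProb (fun f ch => (b ch).run f) ≤ G.value T := by
  have := G.winProb_map (PMF.pure b) fun b f ch => (b ch).run f
  rw [tsum_eq_single b (fun b' hb' => by rw [PMF.pure_apply_of_ne _ _ hb', zero_mul]),
    PMF.pure_apply_self, one_mul] at this
  rw [← this]
  refine le_iSup_of_le (⟨PMF.pure b, fun b' hb' => ?_⟩ : RandAlg Ch D R A T) le_rfl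
  rw [PMF.mem_support_pure_iff] at hb'
  exact hb' ▸ hb

/-- The algorithm sees the challenge, so optimal algorithms for the separate challenges combine into
one. -/
theorem tsum_optPayoff_le_value [Fintype (D → R)] [Nonempty A] (G : Game D R Ch A) (T : ℕ) :
    ∑' ch, optPayoff (fun f => G.accept f ch) (fun f => G.oracle f * G.challenge f ch) T ≤
      G.value T := by
  classical
  choose b hb hbe using fun ch => exists_payoff_eq_optPayoff (fun f => G.accept f ch)
    (fun f => G.oracle f * G.challenge f ch) T
  refine le_trans (le_of_eq ?_) (G.detWinProb_le_value b hb)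
  simp only [← hbe, payoff, detWinProb]
  rw [Summable.tsum_finsetSum fun _ _ => ENNReal.summable, tsum_fintype]
  refine Finset.sum_congr rfl fun f _ => ?_
  rw [← ENNReal.tsum_mul_left]
  refine tsum_congr fun ch => ?_
  by_cases h : (b ch).run f ∈ G.accept f ch <;> simp [h]

theorem delta_nonneg (G : Game D R Ch A) (n T : ℕ) : 0 ≤ G.delta n T :=
  Real.rpow_nonneg ENNReal.toReal_nonneg _

theorem delta_le_one (G : Game D R Ch A) (n T : ℕ) : G.delta n T ≤ 1 :=
  Real.rpow_le_one ENNReal.toReal_nonneg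
    (ENNReal.toReal_mono ENNReal.one_ne_top ((G.multi n).value_le_one (n * T))) (by positivity)

theorem value_multi_le (G : Game D R Ch A) (n T : ℕ) :
    (G.multi n).value (n * T) ≤ ENNReal.ofReal (G.delta n T ^ n) := by
  rcases Nat.eq_zero_or_pos n with rfl | hn
  · simpa using (G.multi 0).value_le_one (0 * T)
  · have h : G.delta n T ^ n = ((G.multi n).value (n * T)).toReal := by
      rw [delta, one_div]
      exact Real.rpow_inv_natCast_pow ENNReal.toReal_nonneg (by omega)
    rw [h, ENNReal.ofReal_toReal]
    exact ne_top_of_le_ne_top ENNReal.one_ne_top ((G.multi n).value_le_one _)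

open Classical in
/-- The winning probability on the `k`-th oracle out of several. -/
noncomputable def saltWinProb {K : ℕ} (G : Game D R Ch A)
    (b : Fin K × Ch → QueryAlg (Fin K × D) R A) (fs : Fin K → D → R) (k : Fin K) : ℝ≥0∞ :=
  ∑' ch, G.challenge (fs k) ch *
    if (b (k, ch)).run (fun z => fs z.1 z.2) ∈ G.accept (fs k) ch then 1 else 0

theorem detWinProb_salted [Fintype (D → R)] (G : Game D R Ch A) (K : ℕ) [NeZero K] {I : Type u}
    (b : I → Fin K × Ch → QueryAlg (Fin K × D) R A) (σ : (Fin K × D → R) → I) :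
    (G.salted K).detWinProb (fun f ch => (b (σ f) ch).run f) =
      ∑ fs : Fin K → D → R, iid G.oracle K fs *
        ((K : ℝ≥0∞)⁻¹ * ∑ k, G.saltWinProb (b (σ fun z => fs z.1 z.2)) fs k) := by
  classical
  simp only [detWinProb, salted, tsum_map_mul, tsum_bind_mul]
  simp only [tsum_fintype, PMF.uniformOfFintype_apply, Fintype.card_fin, Finset.mul_sum,
    saltWinProb]
  rfl

/-- The power `n k` is the probability of answering `n k` independent challenges, achieved by
running the algorithm once for each. For fixed challenges `jointPayoff_le_prod_optPayoff` applies;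
`sum_prod_tsum_le` then sums over them. -/
theorem sum_iid_mul_prod_le [Fintype (D → R)] [Fintype R] [Nonempty A] (G : Game D R Ch A) {K T : ℕ}
    (b : Fin K × Ch → QueryAlg (Fin K × D) R A) (hb : ∀ i, (b i).QueriesAtMost T)
    (n : Fin K → ℕ) :
    ∑ fs : Fin K → D → R, iid G.oracle K fs * ∏ k, G.saltWinProb b fs k ^ n k ≤
      ∏ k, (G.multi (n k)).value (n k * T) := by
  classical
  have hexp : ∀ fs : Fin K → D → R, iid G.oracle K fs * ∏ k, G.saltWinProb b fs k ^ n k =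
      ∏ k, ∑' c : Fin (n k) → Ch,
        if (QueryAlg.sequence (n k) fun i => b (k, c i)).run (fun z => fs z.1 z.2) ∈
            (G.multi (n k)).accept (fs k) c
          then (G.multi (n k)).oracle (fs k) * (G.multi (n k)).challenge (fs k) c else 0 := by
    intro fs
    rw [iid_apply, ← Finset.prod_mul_distrib]
    refine Finset.prod_congr rfl fun k _ => ?_
    rw [saltWinProb, ← tsum_iid_mul_prod, ← ENNReal.tsum_mul_left]
    refine tsum_congr fun c => ?_
    rw [QueryAlg.run_sequence, Finset.prod_ite_zero]
    simp only [multi, Finset.mem_univ, true_imp_iff, Set.mem_ofPred_eq, Finset.prod_const_one, mul_ite,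
      mul_one, mul_zero]
    congr
  simp only [hexp]
  refine (sum_prod_tsum_le _ (fun k c => optPayoff (fun f => (G.multi (n k)).accept f c)
    (fun f => (G.multi (n k)).oracle f * (G.multi (n k)).challenge f c) (n k * T))
    fun c => ?_).trans
    (Finset.prod_le_prod' fun k _ => (G.multi (n k)).tsum_optPayoff_le_value (n k * T))
  have hjoint := jointPayoff_le_prod_optPayoff (fun k f => (G.multi (n k)).accept f (c k))
    (fun k f => (G.multi (n k)).oracle f * (G.multi (n k)).challenge f (c k))
    (fun k => QueryAlg.sequence (n k) fun i => b (k, c k i)) (fun k => n k * T)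
    fun k => QueryAlg.QueriesAtMost.sequence fun i => hb _
  unfold jointPayoff at hjoint
  convert hjoint

theorem sum_iid_mul_mean_pow_le [Fintype (D → R)] [Fintype R] [Nonempty A] (G : Game D R Ch A)
    {K T : ℕ} (b : Fin K × Ch → QueryAlg (Fin K × D) R A) (hb : ∀ i, (b i).QueriesAtMost T)
    (L : ℕ) :
    ∑ fs : Fin K → D → R, iid G.oracle K fs *
        ((K : ℝ≥0∞)⁻¹ * ∑ k, G.saltWinProb b fs k) ^ L ≤
      (K : ℝ≥0∞)⁻¹ ^ L * ∑ n ∈ Finset.piAntidiag (Finset.univ : Finset (Fin K)) L,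
        (Nat.multinomial Finset.univ n : ℝ≥0∞) * ∏ k, (G.multi (n k)).value (n k * T) := by
  calc _ = (K : ℝ≥0∞)⁻¹ ^ L * ∑ n ∈ Finset.piAntidiag (Finset.univ : Finset (Fin K)) L,
        (Nat.multinomial Finset.univ n : ℝ≥0∞) *
          ∑ fs : Fin K → D → R, iid G.oracle K fs * ∏ k, G.saltWinProb b fs k ^ n k := by
        simp only [mul_pow, Finset.sum_pow_eq_sum_piAntidiag]
        simp only [Finset.mul_sum]
        rw [Finset.sum_comm]
        refine Finset.sum_congr rfl fun n _ => Finset.sum_congr rfl fun fs _ => ?_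
        ring
    _ ≤ _ := by
        gcongr with n hn
        exact G.sum_iid_mul_prod_le b hb n

/-! ### The advice bound with a free parameter -/

/-- The bound obtained by guessing the advice in the `L`-challenge version of the salted game. -/
theorem detWinProb_salted_pow_le [Fintype (D → R)] [Fintype R] [Nonempty A] (G : Game D R Ch A)
    {K T L : ℕ} [NeZero K] (hL : 1 ≤ L) {I : Type u} [Fintype I]
    (b : I → Fin K × Ch → QueryAlg (Fin K × D) R A) (hb : ∀ s i, (b s i).QueriesAtMost T)
    (σ : (Fin K × D → R) → I) :
    (G.salted K).detWinProb (fun f ch => (b (σ f) ch).run f) ^ L ≤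
      Fintype.card I * ((K : ℝ≥0∞)⁻¹ ^ L *
        ∑ n ∈ Finset.piAntidiag (Finset.univ : Finset (Fin K)) L,
          (Nat.multinomial Finset.univ n : ℝ≥0∞) * ∏ k, (G.multi (n k)).value (n k * T)) := by
  have hsum : ∑ fs : Fin K → D → R, iid G.oracle K fs = 1 := by
    have := (iid G.oracle K).tsum_coe
    rwa [tsum_fintype] at this
  have hjensen := ENNReal.rpow_arith_mean_le_arith_mean_rpow Finset.univ (iid G.oracle K)
    (fun fs => (K : ℝ≥0∞)⁻¹ * ∑ k, G.saltWinProb (b (σ fun z => fs z.1 z.2)) fs k) hsum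
    (p := L) (by exact_mod_cast hL)
  simp only [ENNReal.rpow_natCast] at hjensen
  rw [detWinProb_salted]
  refine hjensen.trans ?_
  calc _ ≤ ∑ fs : Fin K → D → R, ∑ s, iid G.oracle K fs *
        ((K : ℝ≥0∞)⁻¹ * ∑ k, G.saltWinProb (b s) fs k) ^ L :=
        Finset.sum_le_sum fun fs _ => Finset.single_le_sum (f := fun s => iid G.oracle K fs *
          ((K : ℝ≥0∞)⁻¹ * ∑ k, G.saltWinProb (b s) fs k) ^ L) (fun _ _ => zero_le)
          (Finset.mem_univ _)
    _ ≤ _ := by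
        rw [Finset.sum_comm, ← nsmul_eq_mul]
        exact Finset.sum_le_card_nsmul _ _ _ fun s _ => G.sum_iid_mul_mean_pow_le (b s) (hb s) L

theorem nonempty_answer {D R : Type} {Ch : Type u} {A : Type v} {T : ℕ} {I : Type u}
    (G : Game D R Ch A) (B : RandAlg I D R A T) (i : I) : Nonempty A := by
  obtain ⟨f, -⟩ := G.oracle.support_nonempty
  obtain ⟨b, -⟩ := B.law.support_nonempty
  exact ⟨(b i).run f⟩

theorem detWinProb_salted_le {D R : Type} {Ch : Type u} {A : Type v} [Fintype (D → R)] [Fintype R]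
    [Nonempty A] (G : Game D R Ch A) {K S T L : ℕ} [NeZero K] (hL : 1 ≤ L) {X : ℝ}
    (hX : ∀ n : Fin K → ℕ, ∑ k, n k = L → ∑ k with 1 ≤ n k, G.delta (n k) T ≤ X)
    (b : ((Fin S → Bool) × (Fin K × Ch)) → QueryAlg (Fin K × D) R A)
    (hb : ∀ i, (b i).QueriesAtMost T) (σ : (Fin K × D → R) → (Fin S → Bool)) :
    (G.salted K).detWinProb (fun f ch => (b (σ f, ch)).run f) ≤
      ENNReal.ofReal ((2 : ℝ) ^ ((S : ℝ) / L) * (((K : ℝ) + L) * (Real.exp 1 * X / L) / K)) := by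
  have hK : (0 : ℝ) < K := by exact_mod_cast Nat.pos_of_ne_zero (NeZero.ne K)
  have hX0 : 0 ≤ X :=
    (Finset.sum_nonneg fun k _ => G.delta_nonneg _ _).trans (hX (Pi.single 0 L) (by simp))
  -- `ULift` puts the advice strings into the universe of the challenges.
  have hpow := G.detWinProb_salted_pow_le hL (I := ULift.{u} (Fin S → Bool))
    (fun s i => b (s.down, i)) (fun s i => hb _) (fun f => ⟨σ f⟩)
  have hcard : Fintype.card (ULift.{u} (Fin S → Bool)) = 2 ^ S := by simp
  have htwo : ((2 : ℝ) ^ ((S : ℝ) / L)) ^ L = 2 ^ S := by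
    rw [← Real.rpow_natCast, ← Real.rpow_mul (by norm_num), div_mul_cancel₀, Real.rpow_natCast]
    positivity
  refine (ENNReal.pow_le_pow_left_iff (n := L) (by omega)).1 (hpow.trans ?_)
  rw [hcard, ← ENNReal.ofReal_pow (by positivity)]
  calc ((2 ^ S : ℕ) : ℝ≥0∞) * ((K : ℝ≥0∞)⁻¹ ^ L *
        ∑ n ∈ Finset.piAntidiag (Finset.univ : Finset (Fin K)) L,
          (Nat.multinomial Finset.univ n : ℝ≥0∞) * ∏ k, (G.multi (n k)).value (n k * T))
      ≤ ENNReal.ofReal (2 ^ S) * (ENNReal.ofReal ((K : ℝ)⁻¹ ^ L) *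
        ∑ n ∈ Finset.piAntidiag (Finset.univ : Finset (Fin K)) L,
          ENNReal.ofReal (Nat.multinomial Finset.univ n * ∏ k, G.delta (n k) T ^ n k)) := by
        gcongr ?_ * (?_ * ?_)
        · rw [ENNReal.ofReal_pow (by norm_num)]
          simp
        · rw [ENNReal.ofReal_pow (by positivity), ENNReal.ofReal_inv_of_pos hK,
            ENNReal.ofReal_natCast]
        · refine Finset.sum_le_sum fun n _ => ?_
          rw [ENNReal.ofReal_mul (by positivity), ENNReal.ofReal_natCast,
            ENNReal.ofReal_prod_of_nonneg fun k _ => pow_nonneg (G.delta_nonneg (n k) T) (n k)]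
          exact mul_le_mul_right (Finset.prod_le_prod' fun k _ => G.value_multi_le _ _) _
    _ = ENNReal.ofReal (2 ^ S * ((K : ℝ)⁻¹ ^ L *
        ∑ n ∈ Finset.piAntidiag (Finset.univ : Finset (Fin K)) L,
          Nat.multinomial Finset.univ n * ∏ k, G.delta (n k) T ^ n k)) := by
        rw [← ENNReal.ofReal_sum_of_nonneg fun n _ => mul_nonneg (Nat.cast_nonneg _)
          (Finset.prod_nonneg fun k _ => pow_nonneg (G.delta_nonneg (n k) T) (n k)),
          ← ENNReal.ofReal_mul (by positivity), ← ENNReal.ofReal_mul (by positivity)]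
    _ ≤ _ := by
        refine ENNReal.ofReal_le_ofReal ?_
        rw [mul_pow, htwo, div_eq_mul_inv _ (K : ℝ), mul_pow _ (K : ℝ)⁻¹, mul_comm (_ ^ L) _]
        refine mul_le_mul_of_nonneg_left (mul_le_mul_of_nonneg_right ?_
          (pow_nonneg (inv_nonneg.2 hK.le) L)) (pow_nonneg zero_le_two S)
        exact sum_multinomial_mul_prod_le hL (fun n => G.delta_nonneg n T) hX

/-- The advice bound with a free parameter `L`. -/
theorem epsAdvice_salted_le {D R : Type} {Ch : Type u} {A : Type v} [Fintype (D → R)] [Fintype R]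
    (G : Game D R Ch A) {K T L : ℕ} [NeZero K] (S : ℕ) (hL : 1 ≤ L) {X : ℝ}
    (hX : ∀ n : Fin K → ℕ, ∑ k, n k = L → ∑ k with 1 ≤ n k, G.delta (n k) T ≤ X) :
    (G.salted K).epsAdvice S T ≤
      2 * Real.exp 1 ^ 2 * ((2 : ℝ) ^ ((S : ℝ) / L) * (X / (min K L : ℕ))) := by
  have hK : (0 : ℝ) < K := by exact_mod_cast Nat.pos_of_ne_zero (NeZero.ne K)
  have hL0 : (0 : ℝ) < L := by exact_mod_cast hL
  have hX0 : 0 ≤ X :=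
    (Finset.sum_nonneg fun k _ => G.delta_nonneg _ _).trans (hX (Pi.single 0 L) (by simp))
  have hmin : (0 : ℝ) < (min K L : ℕ) := by
    rw [Nat.cast_min]; exact lt_min hK hL0
  have h1 : (G.salted K).epsAdvice S T ≤
      (2 : ℝ) ^ ((S : ℝ) / L) * (((K : ℝ) + L) * (Real.exp 1 * X / L) / K) := by
    refine ENNReal.toReal_le_of_le_ofReal (by positivity) (iSup₂_le fun σ B => ?_)
    -- The answer type may be empty a priori; running `B` on some input shows that it is not.
    obtain ⟨f, -⟩ := G.oracle.support_nonempty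
    obtain ⟨ch, -⟩ := (G.challenge f).support_nonempty
    have := (G.salted K).nonempty_answer B ((fun _ => false), (0, ch))
    exact (G.salted K).winProb_exec_le B (fun f ch => (σ f, ch)) fun b hb =>
      G.detWinProb_salted_le hL hX b hb σ
  -- The left side is `1 / L + 1 / K`.
  have h2 : ((K : ℝ) + L) / (K * L) ≤ 2 / (min K L : ℕ) := by
    have hkl : (min K L : ℕ) ≤ (K : ℝ) := by exact_mod_cast min_le_left K L
    have hll : (min K L : ℕ) ≤ (L : ℝ) := by exact_mod_cast min_le_right K L
    rw [div_le_div_iff₀ (by positivity) hmin]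
    nlinarith [mul_le_mul_of_nonneg_left hll hK.le, mul_le_mul_of_nonneg_left hkl hL0.le]
  -- The argument loses only one factor `e`; the square matches the stated constant.
  have he : Real.exp 1 ≤ Real.exp 1 ^ 2 :=
    le_self_pow₀ (Real.one_le_exp (by norm_num)) (by norm_num)
  calc (G.salted K).epsAdvice S T
      ≤ (2 : ℝ) ^ ((S : ℝ) / L) * (((K : ℝ) + L) * (Real.exp 1 * X / L) / K) := h1
    _ = Real.exp 1 * (((K : ℝ) + L) / (K * L)) * ((2 : ℝ) ^ ((S : ℝ) / L) * X) := by
        field_simp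
    _ ≤ Real.exp 1 ^ 2 * (2 / (min K L : ℕ)) * ((2 : ℝ) ^ ((S : ℝ) / L) * X) := by gcongr
    _ = _ := by ring

/-! ### Suprema over challenge distributions and the choice of `L` -/

variable (G : Game D R Ch A)

/-- This bounds the families whose real suprema are taken, as `le_ciSup` requires. -/
theorem sum_delta_div_le {K : ℕ} (s : Finset (Fin K)) (n : Fin K → ℕ) (T : ℕ) {d : ℝ}
    (hd : 0 ≤ d) : ∑ k ∈ s, G.delta (n k) T / d ≤ K / d := by
  rw [← Finset.sum_div]
  refine div_le_div_of_nonneg_right ?_ hd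
  calc ∑ k ∈ s, G.delta (n k) T ≤ s.card • (1 : ℝ) :=
        Finset.sum_le_card_nsmul _ _ _ fun k _ => G.delta_le_one _ _
    _ ≤ K := by
        rw [nsmul_eq_mul, mul_one]
        exact_mod_cast (Finset.card_le_univ s).trans_eq (Fintype.card_fin K)

theorem sum_delta_le_mul_iSup {K L : ℕ} (T : ℕ) {d : ℝ} (hd : 0 < d) (n : Fin K → ℕ)
    (hn : ∑ k, n k = L) :
    ∑ k with 1 ≤ n k, G.delta (n k) T ≤
      d * ⨆ n : {n : Fin K → ℕ // ∑ k, n k = L}, ∑ k with 1 ≤ n.1 k, G.delta (n.1 k) T / d := by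
  have hbdd : BddAbove (Set.range fun n : {n : Fin K → ℕ // ∑ k, n k = L} =>
      ∑ k with 1 ≤ n.1 k, G.delta (n.1 k) T / d) :=
    ⟨K / d, by rintro _ ⟨n, rfl⟩; exact G.sum_delta_div_le _ _ T hd.le⟩
  have h := le_ciSup hbdd ⟨n, hn⟩
  rw [← Finset.sum_div, div_le_iff₀ hd, mul_comm] at h
  exact h

theorem sum_delta_le_mul_iSup_pos {K S : ℕ} (T : ℕ) {d : ℝ} (hd : 0 < d) (n : Fin K → ℕ)
    (hn1 : ∀ k, 1 ≤ n k) (hn : ∑ k, n k = S) :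
    ∑ k, G.delta (n k) T ≤
      d * ⨆ n : {n : Fin K → ℕ // (∀ k, 1 ≤ n k) ∧ ∑ k, n k = S},
        ∑ k, G.delta (n.1 k) T / d := by
  have hbdd : BddAbove (Set.range fun n : {n : Fin K → ℕ // (∀ k, 1 ≤ n k) ∧ ∑ k, n k = S} =>
      ∑ k, G.delta (n.1 k) T / d) :=
    ⟨K / d, by rintro _ ⟨n, rfl⟩; exact G.sum_delta_div_le _ _ T hd.le⟩
  have h := le_ciSup hbdd ⟨n, hn1, hn⟩
  rw [← Finset.sum_div, div_le_iff₀ hd, mul_comm] at h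
  exact h

/-- A distribution of `S - K` challenges among at least two salts can be replaced by one of `S`
challenges that reaches every salt. The remaining challenges go to the salt which contributes
least. -/
theorem exists_pos_sum_delta_ge {K S : ℕ} (T : ℕ) (hK : 2 ≤ K) (n : Fin K → ℕ)
    (hn : ∑ k, n k + K = S) :
    ∃ n' : Fin K → ℕ, (∀ k, 1 ≤ n' k) ∧ ∑ k, n' k = S ∧
      ∑ k with 1 ≤ n k, G.delta (n k) T ≤ 2 * ∑ k, G.delta (n' k) T := by
  set v : Fin K → ℝ := fun k => if 1 ≤ n k then G.delta (n k) T else 0 with hv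
  have hv0 : ∀ k, 0 ≤ v k := fun k => by
    simp only [hv]; split_ifs; exacts [G.delta_nonneg _ _, le_rfl]
  obtain ⟨j, -, hj⟩ := Finset.exists_min_image Finset.univ v
    ⟨(⟨0, by omega⟩ : Fin K), Finset.mem_univ _⟩
  obtain ⟨i, hij⟩ : ∃ i : Fin K, i ≠ j := by
    have : Nontrivial (Fin K) := Fin.nontrivial_iff_two_le.2 hK
    exact exists_ne j
  -- Raising the `K - 1` other entries to at least 1 costs at most `K - 1`, so at least one
  -- challenge is left for `j`.
  have hrest : ∑ k ∈ Finset.univ.erase j, max (n k) 1 + 1 ≤ S := by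
    have h1 : ∑ k ∈ Finset.univ.erase j, max (n k) 1 ≤ ∑ k ∈ Finset.univ.erase j, (n k + 1) :=
      Finset.sum_le_sum fun k _ => by omega
    rw [Finset.sum_add_distrib, Finset.sum_const, Finset.card_erase_of_mem (Finset.mem_univ j),
      Finset.card_univ, Fintype.card_fin, smul_eq_mul, mul_one] at h1
    have h2 := Finset.add_sum_erase Finset.univ n (Finset.mem_univ j)
    omega
  set n' : Fin K → ℕ := fun k => if k = j then S - ∑ k ∈ Finset.univ.erase j, max (n k) 1
    else max (n k) 1 with hn'
  have hn'j : n' j = S - ∑ k ∈ Finset.univ.erase j, max (n k) 1 := if_pos rfl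
  have hn'k : ∀ k ∈ Finset.univ.erase j, n' k = max (n k) 1 := fun k hk =>
    if_neg (Finset.ne_of_mem_erase hk)
  refine ⟨n', fun k => ?_, ?_, ?_⟩
  · rcases eq_or_ne k j with rfl | hk
    · rw [hn'j]; omega
    · rw [hn'k k (Finset.mem_erase.2 ⟨hk, Finset.mem_univ k⟩)]; omega
  · rw [← Finset.add_sum_erase _ _ (Finset.mem_univ j), hn'j, Finset.sum_congr rfl hn'k]
    omega
  · have hle : ∑ k ∈ Finset.univ.erase j, v k ≤ ∑ k, G.delta (n' k) T := by
      refine (Finset.sum_le_sum fun k hk => ?_).trans (Finset.sum_le_sum_of_subset_of_nonneg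
        (Finset.erase_subset j _) fun k _ _ => G.delta_nonneg (n' k) T)
      rw [hn'k k hk]
      simp only [hv]
      split_ifs with h
      · rw [max_eq_left h]
      · exact G.delta_nonneg _ _
    -- Only the contribution of `j` can be lost. Being the least, it is at most that of another
    -- salt, whence the factor 2.
    have hvj : v j ≤ ∑ k ∈ Finset.univ.erase j, v k :=
      (hj i (Finset.mem_univ i)).trans (Finset.single_le_sum (fun k _ => hv0 k)
        (Finset.mem_erase.2 ⟨hij, Finset.mem_univ i⟩))
    rw [Finset.sum_filter, ← Finset.add_sum_erase _ _ (Finset.mem_univ j)]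
    change v j + ∑ k ∈ Finset.univ.erase j, v k ≤ _
    linarith

theorem epsAdvice_salted_le_iInf [Fintype (D → R)] [Fintype R] (K : ℕ) [NeZero K] (S T : ℕ) :
    (G.salted K).epsAdvice S T ≤
      2 * Real.exp 1 ^ 2 * ⨅ L : ℕ+, (2 : ℝ) ^ ((S : ℝ) / (L : ℕ)) *
        ⨆ n : {n : Fin K → ℕ // ∑ k, n k = (L : ℕ)},
          ∑ k with 1 ≤ n.1 k, G.delta (n.1 k) T / (min K (L : ℕ) : ℕ) := by
  rw [Real.mul_iInf_of_nonneg (by positivity)]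
  refine le_ciInf fun L => ?_
  have hmin : (0 : ℝ) < (min K (L : ℕ) : ℕ) :=
    Nat.cast_pos.2 (lt_min (Nat.pos_of_ne_zero (NeZero.ne K)) L.pos)
  have h := G.epsAdvice_salted_le (K := K) S L.pos (G.sum_delta_le_mul_iSup T hmin)
  rwa [mul_div_cancel_left₀ _ hmin.ne'] at h

theorem div_min_le {K L : ℕ} [NeZero K] {c : ℝ} (hc : 0 < c) (hL : c * K ≤ L) :
    (K : ℝ) / (min K L : ℕ) ≤ max 1 (1 / c) := by
  have hK : (0 : ℝ) < K := by exact_mod_cast Nat.pos_of_ne_zero (NeZero.ne K)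
  have hL0 : (0 : ℝ) < L := (mul_pos hc hK).trans_le hL
  rcases le_total K L with h | h
  · rw [min_eq_left h, div_self hK.ne']
    exact le_max_left _ _
  · rw [min_eq_right h]
    refine le_trans ?_ (le_max_right _ _)
    rw [div_le_div_iff₀ hL0 hc]
    linarith

/-- Parts (2) and (3) both need `L` comparable to `S`, to bound `2 ^ (S / L)`, and at least of order
`K`, to replace `min K L` by `K`. -/
theorem epsAdvice_salted_le_of_ratio [Fintype (D → R)] [Fintype R] {K S T L : ℕ} [NeZero K]
    {c r : ℝ} (hc : 0 < c) (hL : c * K ≤ L) (hr : S ≤ r * L) {X : ℝ}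
    (hX : ∀ n : Fin K → ℕ, ∑ k, n k = L → ∑ k with 1 ≤ n k, G.delta (n k) T ≤ K * X) :
    (G.salted K).epsAdvice S T ≤ 2 * Real.exp 1 ^ 2 * (2 : ℝ) ^ r * max 1 (1 / c) * X := by
  have hK : (0 : ℝ) < K := by exact_mod_cast Nat.pos_of_ne_zero (NeZero.ne K)
  have hL0 : (0 : ℝ) < L := (mul_pos hc hK).trans_le hL
  have hX0 : 0 ≤ X := nonneg_of_mul_nonneg_right
    ((Finset.sum_nonneg fun k _ => G.delta_nonneg _ _).trans (hX (Pi.single 0 L) (by simp))) hK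
  calc (G.salted K).epsAdvice S T
      ≤ 2 * Real.exp 1 ^ 2 * ((2 : ℝ) ^ ((S : ℝ) / L) * (K * X / (min K L : ℕ))) :=
        G.epsAdvice_salted_le S (by exact_mod_cast hL0) hX
    _ = 2 * Real.exp 1 ^ 2 * (2 : ℝ) ^ ((S : ℝ) / L) * (K / (min K L : ℕ)) * X := by ring
    _ ≤ 2 * Real.exp 1 ^ 2 * (2 : ℝ) ^ r * max 1 (1 / c) * X := by
        gcongr
        · norm_num
        · rwa [div_le_iff₀ hL0]
        · exact div_min_le hc hL

theorem epsAdvice_salted_le_iSup [Fintype (D → R)] [Fintype R] {c : ℝ} (hc : 0 < c) (K : ℕ)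
    [NeZero K] (S T : ℕ) (hS : c * K ≤ S) :
    (G.salted K).epsAdvice S T ≤ 2 * Real.exp 1 ^ 2 * (2 : ℝ) ^ (1 : ℝ) * max 1 (1 / c) *
      ⨆ n : {n : Fin K → ℕ // ∑ k, n k = S}, ∑ k with 1 ≤ n.1 k, G.delta (n.1 k) T / K :=
  G.epsAdvice_salted_le_of_ratio hc hS (by rw [one_mul]) (G.sum_delta_le_mul_iSup T
    (by exact_mod_cast Nat.pos_of_ne_zero (NeZero.ne K)))

theorem epsAdvice_salted_le_iSup_pos [Fintype (D → R)] [Fintype R] {c : ℝ} (hc : 1 < c) (K : ℕ)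
    [NeZero K] (S T : ℕ) (hS : c * K ≤ S) :
    (G.salted K).epsAdvice S T ≤
      2 * Real.exp 1 ^ 2 * (2 : ℝ) ^ (c / (c - 1)) * max 1 (1 / (c - 1)) * 2 *
        ⨆ n : {n : Fin K → ℕ // (∀ k, 1 ≤ n k) ∧ ∑ k, n k = S},
          ∑ k, G.delta (n.1 k) T / K := by
  have hKpos : 0 < K := Nat.pos_of_ne_zero (NeZero.ne K)
  have hK : (0 : ℝ) < K := by exact_mod_cast hKpos
  have hc1 : 0 < c - 1 := sub_pos.2 hc
  have hKS : K ≤ S := by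
    have : (K : ℝ) ≤ S := by nlinarith
    exact_mod_cast this
  have hsup : 0 ≤ ⨆ n : {n : Fin K → ℕ // (∀ k, 1 ≤ n k) ∧ ∑ k, n k = S},
      ∑ k, G.delta (n.1 k) T / K :=
    Real.iSup_nonneg fun n => Finset.sum_nonneg fun k _ => div_nonneg (G.delta_nonneg _ _) hK.le
  rw [mul_assoc _ (2 : ℝ)]
  -- With a single salt there is no second one to compensate for a lost summand, but `L = S` works
  -- directly since `S ≥ 1` forces a positive entry.
  rcases (show K = 1 ∨ 2 ≤ K by omega) with rfl | hK2
  · refine G.epsAdvice_salted_le_of_ratio hc1 (hS.trans' (by simp)) ?_ fun n hn => ?_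
    · rw [div_mul_eq_mul_div, le_div_iff₀ hc1]
      have : (0 : ℝ) ≤ S := by positivity
      linarith
    · have h1 : ∀ k, 1 ≤ n k := by
        intro k
        rw [Subsingleton.elim k 0]
        simp at hn
        omega
      have := G.sum_delta_le_mul_iSup_pos T hK n h1 hn
      rw [Finset.filter_true_of_mem fun k _ => h1 k]
      linarith
  -- For `L = S - K`, the hypothesis `c * K ≤ S` gives `L ≥ (c - 1) * K` and `S ≤ c / (c - 1) * L`.
  · have hcast : ((S - K : ℕ) : ℝ) = S - K := Nat.cast_sub hKS
    refine G.epsAdvice_salted_le_of_ratio (L := S - K) hc1 (by rw [hcast]; linarith) ?_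
      fun n hn => ?_
    · rw [hcast, div_mul_eq_mul_div, le_div_iff₀ hc1]
      linarith
    · obtain ⟨n', h1, h2, h3⟩ := G.exists_pos_sum_delta_ge (S := S) T hK2 n (by omega)
      have := G.sum_delta_le_mul_iSup_pos T hK n' h1 h2
      linarith

end Game

end SaltedGames

/-- In the first two parts a summand with `n k = 0` is omitted, i.e. counted as `0`. -/
theorem mainTheorem8 :
    (∀ (M N : ℕ) (Ch : Type u) (A : Type v) (G : SaltedGames.Game (Fin M) (Fin N) Ch A)
      (K : ℕ) [NeZero K] (S T : ℕ),
      (G.salted K).epsAdvice S T ≤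
        2 * Real.exp 1 ^ 2 * ⨅ L : ℕ+, (2 : ℝ) ^ ((S : ℝ) / (L : ℕ)) *
          ⨆ n : {n : Fin K → ℕ // ∑ k, n k = (L : ℕ)},
            ∑ k with 1 ≤ n.1 k, G.delta (n.1 k) T / (min K (L : ℕ) : ℕ)) ∧
    (∀ c : ℝ, 0 < c → ∃ C : ℝ, 0 < C ∧
      ∀ (M N : ℕ) (Ch : Type u) (A : Type v) (G : SaltedGames.Game (Fin M) (Fin N) Ch A)
        (K : ℕ) [NeZero K] (S T : ℕ), c * K ≤ S →
        (G.salted K).epsAdvice S T ≤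
          C * ⨆ n : {n : Fin K → ℕ // ∑ k, n k = S},
            ∑ k with 1 ≤ n.1 k, G.delta (n.1 k) T / K) ∧
    (∀ c : ℝ, 1 < c → ∃ C : ℝ, 0 < C ∧
      ∀ (M N : ℕ) (Ch : Type u) (A : Type v) (G : SaltedGames.Game (Fin M) (Fin N) Ch A)
        (K : ℕ) [NeZero K] (S T : ℕ), c * K ≤ S →
        (G.salted K).epsAdvice S T ≤
          C * ⨆ n : {n : Fin K → ℕ // (∀ k, 1 ≤ n k) ∧ ∑ k, n k = S},
            ∑ k, G.delta (n.1 k) T / K) := by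
  refine ⟨fun M N Ch A G K _ S T => G.epsAdvice_salted_le_iInf K S T,
    fun c hc => ⟨2 * Real.exp 1 ^ 2 * (2 : ℝ) ^ (1 : ℝ) * max 1 (1 / c), by positivity,
      fun M N Ch A G K _ S T hS => G.epsAdvice_salted_le_iSup hc K S T hS⟩,
    fun c hc => ⟨2 * Real.exp 1 ^ 2 * (2 : ℝ) ^ (c / (c - 1)) * max 1 (1 / (c - 1)) * 2,
      by positivity, fun M N Ch A G K _ S T hS => G.epsAdvice_salted_le_iSup_pos hc K S T hS⟩⟩
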